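/- Let $(b_n)_{n\ge 0}$ be the Baum--Sweet sequence: $b_n=0$ if the binary expansion of $n$ contains a (maximal) block of consecutive $0$'s of odd length, and $b_n=1$ otherwise, with $b_0=1$. Let $D=\sum_{n\ge 1} b_{n-1}X^n\in\mathbb{F}_2[\![X]\!]$, and let $Q=\sum_{n\ge 0} q_nX^n\in\mathbb{F}_2[\![X]\!]$ be the compositional inverse of $D$, i.e. the power series with zero constant term such that $D(Q(X))=Q(D(X))=X$. Regard the coefficients $q_n\in\mathbb{F}_2$ as the integers $0$ and $1$. Then the power series $$\overline{Q}=\sum_{n=0}^{\infty}q_nX^n\in\mathbb{C}[\![X]\!]$$ is transcendental over the field $\mathbb{C}(X)$ of rational functions. -/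

import Mathlib

open scoped PowerSeries LaurentSeries RatFunc

/-- The binary expansion of `n` contains a (maximal) block of zeros of odd length `l`,
occupying the positions `i, …, i + l - 1`. The block is followed on the left (at position `i + l`)
by a digit `1`, since the leading digit is `1`, and on the right either the expansion ends
or there is a digit `1`. The expansion of `0` is empty, so it contains no such block. -/
def HasOddZeroBlock (n : ℕ) : Prop :=
  ∃ i l : ℕ, Odd l ∧ (∀ j, i ≤ j → j < i + l → n.testBit j = false) ∧
    n.testBit (i + l) = true ∧ (i = 0 ∨ n.testBit (i - 1) = true)

open Classical in
/-- The Baum--Sweet sequence `b`. -/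
noncomputable def baumSweet (n : ℕ) : ℕ := if HasOddZeroBlock n then 0 else 1

/-- The shifted Baum--Sweet sequence: `b''_0 = 0` and `b''_n = b_{n-1}` for `n ≥ 1`. -/
noncomputable def baumSweetShift : ℕ → ℕ
  | 0 => 0
  | n + 1 => baumSweet n

/-- The series `D = ∑ b''_n X^n` over the field with two elements. -/
noncomputable def seriesD : (ZMod 2)⟦X⟧ :=
  PowerSeries.mk fun n => (baumSweetShift n : ZMod 2)

theorem baumSweet_zero : baumSweet 0 = 1 := by
  have h : ¬ HasOddZeroBlock 0 := by
    rintro ⟨i, l, -, -, h, -⟩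
    simp at h
  simp [baumSweet, h]

theorem constantCoeff_seriesD : PowerSeries.constantCoeff seriesD = 0 := by
  rw [← PowerSeries.coeff_zero_eq_constantCoeff_apply]
  simp [seriesD, baumSweetShift]

theorem isUnit_coeff_one_seriesD : IsUnit (PowerSeries.coeff 1 seriesD) := by
  simp [seriesD, baumSweetShift, baumSweet_zero]

/-- The series `Q`: the compositional inverse of `D` over the field with two elements. -/
noncomputable def seriesQ : (ZMod 2)⟦X⟧ :=
  seriesD.substInvOfIsUnit isUnit_coeff_one_seriesD

/-- `D(Q(X)) = X`. -/
theorem seriesD_subst_seriesQ : seriesD.subst seriesQ = (PowerSeries.X : (ZMod 2)⟦X⟧) :=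
  PowerSeries.subst_substInvOfIsUnit_right _ constantCoeff_seriesD isUnit_coeff_one_seriesD

/-- `Q(D(X)) = X`. -/
theorem seriesQ_subst_seriesD : seriesQ.subst seriesD = (PowerSeries.X : (ZMod 2)⟦X⟧) :=
  PowerSeries.subst_substInvOfIsUnit_left _ constantCoeff_seriesD isUnit_coeff_one_seriesD

/-- The coefficients `q_n` of `Q`, regarded as the integers `0` and `1`. -/
noncomputable def qSeq (n : ℕ) : ℕ := (PowerSeries.coeff n seriesQ).val

/-- The series `∑ q_n X^n` with complex coefficients. -/
noncomputable def seriesQbar : ℂ⟦X⟧ := PowerSeries.mk fun n => (qSeq n : ℂ)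

/-! In characteristic 0 an algebraic series satisfies a linear differential equation over the
polynomials, so its coefficients satisfy a recurrence with polynomial coefficients
(`exists_sum_eq_zero_of_isAlgebraic`). A nonzero coefficient after a long gap forces a root of the
lowest nonzero recurrence polynomial; infinitely many such roots are impossible
(`transcendental_of_gaps`). Modulo 2, the Baum–Sweet cubic inverts to `(1 + X) Q³ = X³`, whence `X³
Q = (1 + X) Q⁴`. Frobenius turns this into a base-4 recursion for `qSeq`, which produces the gaps.
-/

/-! ### Derivatives of algebraic elements -/

section AlgebraicDerivatives

open scoped Differential IntermediateField

/-- The derivative of an algebraic element lies in the field generated by that element. -/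
theorem algebraMap_deriv_mem_adjoin (A : Type*) {R K L : Type*} [CommRing A] [IsDomain A]
    [CommRing R] [Algebra A R] [Field K] [CharZero K] [Algebra A K] [IsFractionRing A K] [Field L]
    [Algebra R L] [FaithfulSMul R L] [Algebra A L] [Algebra K L] [IsScalarTower A K L]
    [IsScalarTower A R L] [Differential A] [Differential R] [DifferentialAlgebra A R]
    {h : R} (hh : IsIntegral K (algebraMap R L h)) :
    algebraMap R L h′ ∈ K⟮algebraMap R L h⟯ := by
  set x := algebraMap R L h with hx
  obtain ⟨c, hc, hq⟩ := IsLocalization.integerNormalization_spec (nonZeroDivisors A) (minpoly K x)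
  set q := IsLocalization.integerNormalization (nonZeroDivisors A) (minpoly K x)
  have hc0 : algebraMap A K c ≠ 0 := by simpa using nonZeroDivisors.ne_zero hc
  have haeval : ∀ p : Polynomial A, algebraMap R L (Polynomial.aeval h p) =
      Polynomial.aeval x (p.map (algebraMap A K)) := fun p => by
    rw [Polynomial.aeval_map_algebraMap, hx, Polynomial.aeval_algebraMap_apply]
  have hq' : q.map (algebraMap A K) = Polynomial.C (algebraMap A K c) * minpoly K x := by
    rw [hq, ← Polynomial.smul_eq_C_mul, algebraMap_smul]
  have h0 : Polynomial.aeval h q = 0 := by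
    apply FaithfulSMul.algebraMap_injective R L
    rw [haeval, hq', map_mul, minpoly.aeval, mul_zero, map_zero]
  -- Irreducible polynomials are separable in characteristic 0, so the derivative of `h` can be
  -- solved for after differentiating `q(h) = 0`.
  have h1 : Polynomial.aeval x ((Polynomial.derivative q).map (algebraMap A K)) ≠ 0 := by
    rw [← Polynomial.derivative_map, hq', Polynomial.derivative_C_mul, map_mul, Polynomial.aeval_C]
    exact mul_ne_zero (by simpa using hc0)
      ((minpoly.irreducible hh).separable.aeval_derivative_ne_zero (minpoly.aeval K x))
  have key := congrArg (algebraMap R L) (Differential.deriv_aeval_eq h q)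
  rw [h0, map_zero, map_zero, map_add, map_mul, haeval, haeval] at key
  have hmem : ∀ p : Polynomial K, Polynomial.aeval x p ∈ K⟮x⟯ := fun p =>
    IntermediateField.algebra_adjoin_le_adjoin K _ (Polynomial.aeval_mem_adjoin_singleton K x)
  have hdiv := eq_div_of_mul_eq h1
    ((mul_comm _ _).trans (eq_neg_of_add_eq_zero_right key.symm))
  rw [hdiv]
  exact div_mem (neg_mem (hmem _)) (hmem _)

/-- The iterated derivatives of an algebraic element are linearly dependent. -/
theorem not_linearIndependent_iterate_deriv (A : Type*) {R K L : Type*} [CommRing A] [IsDomain A]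
    [CommRing R] [Algebra A R] [Field K] [CharZero K] [Algebra A K] [IsFractionRing A K] [Field L]
    [Algebra R L] [FaithfulSMul R L] [Algebra A L] [Algebra K L] [IsScalarTower A K L]
    [IsScalarTower A R L] [Differential A] [Differential R] [DifferentialAlgebra A R]
    {f : R} (hf : IsIntegral K (algebraMap R L f)) :
    ¬ LinearIndependent A fun i : ℕ => Differential.deriv^[i] f := by
  intro hli
  have := IntermediateField.adjoin.finiteDimensional hf
  have hmem : ∀ i : ℕ, algebraMap R L (Differential.deriv^[i] f) ∈ K⟮algebraMap R L f⟯ := by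
    intro i
    induction i with
    | zero => exact IntermediateField.mem_adjoin_simple_self K _
    | succ i ih =>
      rw [Function.iterate_succ_apply']
      have hint : IsIntegral K (algebraMap R L (Differential.deriv^[i] f)) :=
        (IsIntegral.of_finite K (⟨_, ih⟩ : K⟮algebraMap R L f⟯)).map
          (IntermediateField.val K⟮algebraMap R L f⟯)
      exact IntermediateField.adjoin_simple_le_iff.2 ih (algebraMap_deriv_mem_adjoin A hint)
  have hL : LinearIndependent K fun i : ℕ => algebraMap R L (Differential.deriv^[i] f) := by
    rw [← LinearIndependent.iff_fractionRing (R := A)]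
    exact hli.map' (IsScalarTower.toAlgHom A R L).toLinearMap
      (LinearMap.ker_eq_bot.2 (FaithfulSMul.algebraMap_injective R L))
  have hF : LinearIndependent K fun i : ℕ => (⟨_, hmem i⟩ : K⟮algebraMap R L f⟯) :=
    LinearIndependent.of_comp (IntermediateField.val K⟮algebraMap R L f⟯).toLinearMap hL
  exact not_finite_iff_infinite.2 inferInstance hF.finite

end AlgebraicDerivatives

/-! ### Differential equations and the gap criterion -/

/-- The differential ring structure given by a derivation. -/
abbrev Derivation.toDifferential {F R : Type*} [CommRing F] [CommRing R] [Algebra F R]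
    (D : Derivation F R R) : Differential R :=
  ⟨D.restrictScalars ℤ⟩

namespace PowerSeries

open scoped Polynomial

/-- The derivation `X d/dX` on power series. -/
noncomputable abbrev eulerDifferential (F : Type*) [CommRing F] : Differential F⟦X⟧ :=
  ((X : F⟦X⟧) • derivative F).toDifferential

/-- The derivation `X d/dX` on polynomials. -/
noncomputable abbrev _root_.Polynomial.eulerDifferential (F : Type*) [CommRing F] :
    Differential F[X] :=
  ((Polynomial.X : F[X]) • Polynomial.derivative' (R := F)).toDifferential

/-- Unlike `d/dX`, the Euler operator shifts no index, so the recurrence below comes out directly in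
terms of polynomials in the index. -/
theorem coeff_iterate_X_smul_derivative {F : Type*} [CommRing F] (f : F⟦X⟧) (i n : ℕ) :
    coeff n ((eulerDifferential F).deriv^[i] f) = (n : F) ^ i * coeff n f := by
  induction i with
  | zero => simp
  | succ i ih =>
    rw [Function.iterate_succ_apply', pow_succ', mul_assoc, ← ih]
    change coeff n (X * derivative F _) = _
    cases n with
    | zero => simp
    | succ n =>
      rw [coeff_succ_X_mul, coeff_derivative]
      push_cast
      ring

/-- An algebraic power series satisfies a linear differential equation in `X d/dX`
with polynomial coefficients. -/
theorem exists_sum_eq_zero_of_isAlgebraic {F : Type*} [Field F] [CharZero F] {f : F⟦X⟧}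
    (hf : IsAlgebraic (RatFunc F) (f : F⸨X⸩)) :
    ∃ (s : Finset ℕ) (g : ℕ → F[X]), (∃ i ∈ s, g i ≠ 0) ∧
      ∑ i ∈ s, (g i : F⟦X⟧) * (eulerDifferential F).deriv^[i] f = 0 := by
  let _ := eulerDifferential F
  let _ := Polynomial.eulerDifferential F
  have halg : ∀ p : F[X], algebraMap F[X] F⟦X⟧ p = p := fun p => by
    simp [algebraMap_apply']
  have : DifferentialAlgebra F[X] F⟦X⟧ := ⟨fun p => by
    rw [halg, halg]
    change X * derivative F (p : F⟦X⟧) =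
      ((Polynomial.X * Polynomial.derivative p : F[X]) : F⟦X⟧)
    rw [derivative_coe, Polynomial.coe_mul, Polynomial.coe_X]⟩
  have : IsScalarTower F[X] F⟦X⟧ F⸨X⸩ := IsScalarTower.of_algebraMap_eq fun p => rfl
  have hdep := not_linearIndependent_iterate_deriv F[X] (R := F⟦X⟧) (L := F⸨X⸩) hf.isIntegral
  rw [not_linearIndependent_iff] at hdep
  obtain ⟨s, g, hsum, hne⟩ := hdep
  refine ⟨s, g, hne, ?_⟩
  simpa only [Algebra.smul_def, halg] using hsum

/-- A power series with infinitely many nonzero coefficients, some of which are preceded by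
arbitrarily long blocks of zeros, is transcendental. -/
theorem transcendental_of_gaps {F : Type*} [Field F] [CharZero F] {f : F⟦X⟧}
    (hgap : ∀ J, ∃ m, J ≤ m ∧ coeff m f ≠ 0 ∧ ∀ i < m, m ≤ i + J → coeff i f = 0) :
    Transcendental (RatFunc F) (f : F⸨X⸩) := by
  intro hf
  obtain ⟨s, g, ⟨i₀, hi₀, hg⟩, hsum⟩ := exists_sum_eq_zero_of_isAlgebraic hf
  let q : ℕ → F[X] := fun j => ∑ i ∈ s, Polynomial.monomial i ((g i).coeff j)
  have hrec : ∀ n, ∑ p ∈ Finset.HasAntidiagonal.antidiagonal n, (q p.1).eval (p.2 : F) * coeff p.2 f = 0 := by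
    intro n
    have := congrArg (coeff n) hsum
    simp only [map_sum, coeff_mul, map_zero, coeff_iterate_X_smul_derivative,
      Polynomial.coeff_coe] at this
    rw [Finset.sum_comm] at this
    simpa only [q, Polynomial.eval_finsetSum, Polynomial.eval_monomial, Finset.sum_mul,
      mul_assoc] using this
  have hq : ∃ j, q j ≠ 0 := by
    obtain ⟨j, hj⟩ : ∃ j, (g i₀).coeff j ≠ 0 := by
      by_contra! h
      exact hg (Polynomial.ext h)
    refine ⟨j, fun h => hj ?_⟩
    have := congrArg (Polynomial.coeff · i₀) h
    simpa [q, Polynomial.finsetSum_coeff, Polynomial.coeff_monomial, hi₀] using this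
  classical
  let B := s.sup fun i => (g i).natDegree
  have hB : ∀ j, B < j → q j = 0 := fun j hj => Finset.sum_eq_zero fun i hi => by
    rw [Polynomial.coeff_eq_zero_of_natDegree_lt ((Finset.le_sup (f := fun i =>
      (g i).natDegree) hi).trans_lt hj), Polynomial.monomial_zero_right]
  have hroot : ∀ N : ℕ, ∃ m : ℕ, N < m ∧ (q (Nat.find hq)).IsRoot (m : F) := by
    intro N
    -- At index `m` plus the least `j` with `q j ≠ 0`, only the term in `coeff m f` survives:
    -- smaller `j` vanish by minimality, larger ones up to `B` by the gap.
    obtain ⟨m, hm, hne, hzero⟩ := hgap (B + N + 1)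
    refine ⟨m, by omega, ?_⟩
    have h := hrec (Nat.find hq + m)
    rw [Finset.sum_eq_single (Nat.find hq, m)] at h
    · exact (mul_eq_zero.1 h).resolve_right hne
    · rintro ⟨j, k⟩ hjk hne'
      rw [Finset.HasAntidiagonal.mem_antidiagonal] at hjk
      dsimp only at hjk ⊢
      rcases lt_trichotomy j (Nat.find hq) with hj | hj | hj
      · rw [not_not.1 (Nat.find_min hq hj), Polynomial.eval_zero, zero_mul]
      · exact absurd (Prod.ext hj (by dsimp only; omega)) hne'
      · rcases lt_or_ge B j with hBj | hBj
        · rw [hB j hBj, Polynomial.eval_zero, zero_mul]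
        · rw [hzero k (by omega) (by omega), mul_zero]
    · simp
  refine Nat.find_spec hq (Polynomial.eq_zero_of_infinite_isRoot _ ?_)
  have hinf : {m : ℕ | (q (Nat.find hq)).IsRoot (m : F)}.Infinite :=
    Set.infinite_of_forall_exists_gt fun N => (hroot N).imp fun m hm => ⟨hm.2, hm.1⟩
  refine (hinf.image Nat.cast_injective.injOn).mono ?_
  rintro _ ⟨m, hm, rfl⟩
  exact hm

end PowerSeries

/-! ### Digit recursions for the Baum–Sweet sequence -/

theorem hasOddZeroBlock_two_mul_add_one (n : ℕ) :
    HasOddZeroBlock (2 * n + 1) ↔ HasOddZeroBlock n := by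
  have hs : ∀ j, (2 * n + 1).testBit (j + 1) = n.testBit j := fun j => by
    rw [Nat.testBit_succ]; congr 1; omega
  have h0 : (2 * n + 1).testBit 0 = true := by simp
  constructor
  · rintro ⟨i, l, hl, hz, ht, hi⟩
    obtain _ | i := i
    · simp [hz 0 le_rfl (by simpa using hl.pos)] at h0
    · refine ⟨i, l, hl, fun j h1 h2 => ?_, ?_, ?_⟩
      · rw [← hs]; exact hz _ (by omega) (by omega)
      · rw [← hs, ← ht]; congr 1; omega
      · obtain _ | i := i
        · exact Or.inl rfl
        · right; rw [← hs]; simpa using hi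
  · rintro ⟨i, l, hl, hz, ht, hi⟩
    refine ⟨i + 1, l, hl, fun j h1 h2 => ?_, ?_, ?_⟩
    · obtain ⟨j, rfl⟩ := Nat.exists_eq_add_of_le' (show 1 ≤ j by omega)
      rw [hs]; exact hz _ (by omega) (by omega)
    · rw [show i + 1 + l = i + l + 1 by omega, hs, ht]
    · right
      obtain _ | i := i
      · simp
      · simpa [hs] using hi

theorem hasOddZeroBlock_four_mul_add_two (n : ℕ) : HasOddZeroBlock (4 * n + 2) := by
  refine ⟨0, 1, odd_one, fun j _ h => ?_, ?_, Or.inl rfl⟩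
  · obtain rfl : j = 0 := by omega
    simp only [Nat.testBit_zero, decide_eq_false_iff_not]
    omega
  · rw [Nat.testBit_succ, Nat.testBit_zero, decide_eq_true_eq]; omega

/-- Two appended zeros preserve the parity of the trailing zero block. -/
theorem hasOddZeroBlock_four_mul (n : ℕ) : HasOddZeroBlock (4 * n) ↔ HasOddZeroBlock n := by
  have hs : ∀ j, (4 * n).testBit (j + 2) = n.testBit j := fun j => by
    rw [Nat.testBit_succ, Nat.testBit_succ]; congr 1; omega
  have h0 : (4 * n).testBit 0 = false := by
    rw [Nat.testBit_zero, decide_eq_false_iff_not]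
    omega
  have h1 : (4 * n).testBit 1 = false := by
    rw [Nat.testBit_succ, Nat.testBit_zero, decide_eq_false_iff_not]; omega
  constructor
  · rintro ⟨i, l, hl, hz, ht, hi⟩
    match i, hi with
    | 0, _ =>
      obtain ⟨k, rfl⟩ := hl
      obtain _ | k := k
      · simp [h1] at ht
      · refine ⟨0, 2 * k + 1, ⟨k, rfl⟩, fun j _ h2 => ?_, ?_, Or.inl rfl⟩
        · rw [← hs]; exact hz _ (by omega) (by omega)
        · rw [← hs, ← ht]; congr 1
    | 1, hi => simp [h0] at hi
    | 2, hi => simp [h1] at hi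
    | i + 3, hi =>
      refine ⟨i + 1, l, hl, fun j h1 h2 => ?_, ?_, Or.inr ?_⟩
      · rw [← hs]; exact hz _ (by omega) (by omega)
      · rw [← hs, ← ht]; congr 1; omega
      · rw [← hs]; simpa using hi
  · rintro ⟨i, l, hl, hz, ht, hi⟩
    obtain _ | i := i
    · refine ⟨0, l + 2, hl.add_even even_two, fun j _ h3 => ?_, ?_, Or.inl rfl⟩
      · match j with
        | 0 => exact h0
        | 1 => exact h1
        | j + 2 => rw [hs]; exact hz _ (by omega) (by omega)
      · rw [← ht, ← hs]; congr 1
    · refine ⟨i + 3, l, hl, fun j h3 h4 => ?_, ?_, Or.inr ?_⟩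
      · obtain ⟨j, rfl⟩ := Nat.exists_eq_add_of_le' (show 2 ≤ j by omega)
        rw [hs]; exact hz _ (by omega) (by omega)
      · rw [← ht, ← hs]; congr 1; omega
      · rw [show i + 3 - 1 = i + 2 by omega, hs]; simpa using hi

theorem baumSweet_two_mul_add_one (n : ℕ) : baumSweet (2 * n + 1) = baumSweet n := by
  classical
  unfold baumSweet
  exact if_congr (hasOddZeroBlock_two_mul_add_one n) rfl rfl

theorem baumSweet_four_mul_add_two (n : ℕ) : baumSweet (4 * n + 2) = 0 :=
  if_pos (hasOddZeroBlock_four_mul_add_two n)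

theorem baumSweet_four_mul (n : ℕ) : baumSweet (4 * n) = baumSweet n := by
  classical
  unfold baumSweet
  exact if_congr (hasOddZeroBlock_four_mul n) rfl rfl

/-! ### Algebraic equations modulo 2 -/

namespace PowerSeries

theorem coeff_pow_two (f : (ZMod 2)⟦X⟧) (n : ℕ) :
    coeff n (f ^ 2) = if 2 ∣ n then coeff (n / 2) f else 0 := by
  rw [← coeff_expand 2 two_ne_zero]
  have h := MvPowerSeries.map_frobenius_expand 2 two_ne_zero (f := f)
  rw [ZMod.frobenius_zmod] at h
  rw [← h]
  rfl

theorem coeff_pow_four (f : (ZMod 2)⟦X⟧) (n : ℕ) :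
    coeff n (f ^ 4) = if 4 ∣ n then coeff (n / 4) f else 0 := by
  rw [show f ^ 4 = (f ^ 2) ^ 2 by ring, coeff_pow_two, coeff_pow_two, Nat.div_div_eq_div_mul]
  split_ifs <;> first | rfl | omega

end PowerSeries

theorem PowerSeries.two_eq_zero : (2 : (ZMod 2)⟦X⟧) = 0 := by
  rw [← map_ofNat (C (R := ZMod 2)) 2, show (OfNat.ofNat 2 : ZMod 2) = 0 from rfl, map_zero]

open PowerSeries in
/-- The cubic equation of the Baum--Sweet series. -/
theorem seriesD_cubic : seriesD ^ 3 + X ^ 3 * seriesD + X ^ 3 = 0 := by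
  set B : (ZMod 2)⟦X⟧ := mk fun n => (baumSweet n : ZMod 2)
  -- `X * B ^ 2` carries the odd indices, `B ^ 4` the multiples of 4.
  have hB : B = X * B ^ 2 + B ^ 4 := by
    ext n
    rw [map_add, coeff_pow_four]
    obtain ⟨k, rfl | rfl | rfl⟩ : ∃ k, n = 2 * k + 1 ∨ n = 4 * k ∨ n = 4 * k + 2 :=
      ⟨if n % 2 = 1 then n / 2 else n / 4, by split_ifs <;> omega⟩
    · rw [coeff_succ_X_mul, coeff_pow_two, if_pos (by omega), if_neg (by omega)]
      simp [B, baumSweet_two_mul_add_one]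
    · rw [if_pos (by omega)]
      obtain _ | k := k
      · simp [B]
      · rw [show 4 * (k + 1) = (4 * k + 3) + 1 by ring, coeff_succ_X_mul, coeff_pow_two,
          if_neg (by omega), show (4 * k + 3 + 1) / 4 = k + 1 by omega,
          show 4 * k + 3 + 1 = 4 * (k + 1) by ring]
        simp [B, baumSweet_four_mul]
    · rw [coeff_succ_X_mul, coeff_pow_two, if_neg (by omega), if_neg (by omega)]
      simp [B, baumSweet_four_mul_add_two]
  have hD : seriesD = X * B := by
    ext n
    obtain _ | n := n
    · simp [seriesD, baumSweetShift]
    · rw [coeff_succ_X_mul]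
      simp [seriesD, baumSweetShift, B]
  have hB0 : B ≠ 0 := fun h => by
    have := congrArg (coeff 0) h
    simp [B, baumSweet_zero] at this
  have hB3 : B ^ 3 + X * B + 1 = 0 := by
    apply mul_left_cancel₀ hB0
    linear_combination (-1 : (ZMod 2)⟦X⟧) * hB + B * two_eq_zero
  rw [hD]
  linear_combination X ^ 3 * hB3

-- Substituting `Q` in the cubic sends `D` to `X` and `X` to `Q`.
open PowerSeries in
theorem one_add_X_mul_seriesQ_pow : (1 + X) * seriesQ ^ 3 = X ^ 3 := by
  have hQ : HasSubst seriesQ := HasSubst.substInvOfIsUnit _ _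
  have h := congrArg (substAlgHom hQ) seriesD_cubic
  simp only [map_add, map_mul, map_pow, map_zero, coe_substAlgHom, seriesD_subst_seriesQ,
    subst_X hQ] at h
  linear_combination h - X ^ 3 * two_eq_zero

open PowerSeries in
theorem coeff_seriesQ (n : ℕ) : coeff n seriesQ =
    (if 4 ∣ n + 3 then coeff ((n + 3) / 4) seriesQ else 0) +
      if 4 ∣ n + 2 then coeff ((n + 2) / 4) seriesQ else 0 := by
  have h : X ^ 3 * seriesQ = seriesQ ^ 4 + X * seriesQ ^ 4 := by
    linear_combination (-seriesQ) * one_add_X_mul_seriesQ_pow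
  have := congrArg (coeff (n + 3)) h
  rwa [coeff_X_pow_mul, map_add, coeff_succ_X_mul, coeff_pow_four, coeff_pow_four] at this

/-! ### Gaps in the coefficients of `Q` -/

theorem qSeq_four_mul_add_one (n : ℕ) : qSeq (4 * n + 1) = qSeq (n + 1) := by
  rw [qSeq, coeff_seriesQ, if_pos (by omega), if_neg (by omega), add_zero, qSeq]
  congr 3; omega

theorem qSeq_four_mul_add_two (n : ℕ) : qSeq (4 * n + 2) = qSeq (n + 1) := by
  rw [qSeq, coeff_seriesQ, if_neg (by omega), if_pos (by omega), zero_add, qSeq]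
  congr 3; omega

theorem qSeq_eq_zero {n : ℕ} (h : n % 4 = 0 ∨ n % 4 = 3) : qSeq n = 0 := by
  rw [qSeq, coeff_seriesQ, if_neg (by omega), if_neg (by omega)]
  simp

theorem qSeq_one : qSeq 1 = 1 := by
  have h : PowerSeries.coeff 1 seriesQ = 1 := by
    rw [seriesQ, PowerSeries.coeff_one_substInvOfIsUnit]
    exact congrArg Units.val (Subsingleton.elim isUnit_coeff_one_seriesD.unit⁻¹ 1)
  rw [qSeq, h]
  rfl

/-- The map `m ↦ 4m - 3` preserves `qSeq m` and lengthens the gap before `m`. It fixes 1, so the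
induction starts at 2. -/
theorem exists_qSeq_gap (J : ℕ) :
    ∃ m, J + 2 ≤ m ∧ qSeq m ≠ 0 ∧ ∀ i < m, m ≤ i + J → qSeq i = 0 := by
  induction J with
  | zero =>
    refine ⟨2, le_rfl, ?_, fun i h1 h2 => by omega⟩
    rw [qSeq_four_mul_add_two 0, qSeq_one]
    exact one_ne_zero
  | succ J ih =>
    obtain ⟨m, hm, hne, hz⟩ := ih
    obtain ⟨k, rfl⟩ := Nat.exists_eq_add_of_le' (show 1 ≤ m by omega)
    refine ⟨4 * k + 1, by omega, by rwa [qSeq_four_mul_add_one], fun i h1 h2 => ?_⟩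
    by_cases hi : i % 4 = 0 ∨ i % 4 = 3
    · exact qSeq_eq_zero hi
    · have hz' := hz (i / 4 + 1) (by omega) (by omega)
      rcases (show i = 4 * (i / 4) + 1 ∨ i = 4 * (i / 4) + 2 by omega) with h | h
      · rw [h, qSeq_four_mul_add_one, hz']
      · rw [h, qSeq_four_mul_add_two, hz']

theorem mainTheorem5 : Transcendental (RatFunc ℂ) (seriesQbar : ℂ⸨X⸩) := by
  refine PowerSeries.transcendental_of_gaps fun J => ?_
  obtain ⟨m, hm, hne, hz⟩ := exists_qSeq_gap J
  refine ⟨m, by omega, ?_, fun i h1 h2 => ?_⟩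
  · simpa [seriesQbar] using hne
  · simpa [seriesQbar] using hz i h1 h2
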